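/- Let $g\ge 0$ be an integer and let $\mathbb{R}\langle x,x^*\rangle$ be the free $*$-algebra over $\mathbb{R}$ in the noncommuting variables $x_1,\dots,x_g$ and their formal adjoints $x_1^*,\dots,x_g^*$. The degree of a polynomial is the length of the longest word occurring in it. A polynomial is analytic if no $x_j^*$ occurs in it, and homogeneous if it is a linear combination of words of one and the same length. A $*$-ideal is a left ideal $I$ with $I^*=I$. For a positive integer $n$ and a $g$-tuple $X=(X_1,\dots,X_g)$ of real $n\times n$ matrices, $p(X)$ denotes the result of substituting $X_j$ for $x_j$ and the adjoint of $X_j$ for $x_j^*$ in $p$. The hard radical of $I$ is $$\sqrt[\mathrm{hard}]{I}=\{q\in\mathbb{R}\langle x,x^*\rangle : q(X)=0 \text{ for every } n\ge 1 \text{ and every } X\in M_n(\mathbb{R})^g \text{ such that } p(X)=0 \text{ for all } p\in I\}.$$ Let $P\subseteq\mathbb{R}\langle x,x^*\rangle$ be a (not necessarily finite) set of homogeneous analytic polynomials, not necessarily of the same degree, and let $I$ be the $*$-ideal generated by $P$, that is, the smallest $*$-ideal containing $P$. (a) If $I\ne\mathbb{R}\langle x,x^*\rangle$, then for every integer $d\ge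 0$ there exist $n\ge 1$ and $X\in M_n(\mathbb{R})^g$ such that $p(X)=0$ for every $p\in I$ and $q(X)\neq 0$ for every $q\notin I$ of degree at most $d$. (b) $\sqrt[\mathrm{hard}]{I}=I$. -/

import Mathlib

namespace FreeStar

/-- The `2g` noncommuting letters: `Sum.inl j` is `x_j` and `Sum.inr j` is `x_j^*`. -/
abbrev Letter (g : ℕ) : Type := Fin g ⊕ Fin g

/-- Words in the letters `x_1, …, x_g, x_1^*, …, x_g^*`. -/
abbrev Word (g : ℕ) : Type := FreeMonoid (Letter g)

/-- The free `*`-algebra `ℝ⟨x, x^*⟩`: the monoid algebra of the free monoid of words. -/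
abbrev NCPoly (g : ℕ) : Type := MonoidAlgebra ℝ (Word g)

/-- The involution on words: reverse the word and exchange `x_j` with `x_j^*`. -/
def wordAdj {g : ℕ} (w : Word g) : Word g :=
  FreeMonoid.ofList ((FreeMonoid.toList w).map Sum.swap).reverse

/-- The involution `p ↦ p^*` on `ℝ⟨x, x^*⟩`, the linear extension of the involution on words
(real coefficients are fixed by conjugation). -/
noncomputable def adj {g : ℕ} (p : NCPoly g) : NCPoly g :=
  MonoidAlgebra.mapDomain wordAdj p

/-- The degree: the length of the longest word occurring in `p` (and `0` for `p = 0`). -/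
noncomputable def degree {g : ℕ} (p : NCPoly g) : ℕ :=
  p.coeff.support.sup FreeMonoid.length

/-- Analytic polynomials: no word occurring in `p` contains a letter `x_j^*`. -/
def IsAnalytic {g : ℕ} (p : NCPoly g) : Prop :=
  ∀ w ∈ p.coeff.support, ∀ l ∈ FreeMonoid.toList w, ∃ j : Fin g, l = Sum.inl j

/-- Homogeneous polynomials: all the words occurring in `p` have the same length. -/
def IsHomogeneous {g : ℕ} (p : NCPoly g) : Prop :=
  ∃ k : ℕ, ∀ w ∈ p.coeff.support, FreeMonoid.length w = k

/-- A `*`-ideal is a left ideal `I` with `I^* = I` (`Ideal` means left ideal here). -/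
def IsStarIdeal {g : ℕ} (I : Ideal (NCPoly g)) : Prop :=
  adj '' (I : Set (NCPoly g)) = (I : Set (NCPoly g))

/-- The `*`-ideal generated by `P`: the intersection of all `*`-ideals containing `P`. -/
noncomputable def starIdealSpan {g : ℕ} (P : Set (NCPoly g)) : Ideal (NCPoly g) :=
  sInf {J : Ideal (NCPoly g) | IsStarIdeal J ∧ P ⊆ (J : Set (NCPoly g))}

/-- `g`-tuples of real `n × n` matrices. -/
abbrev MatTuple (g n : ℕ) : Type := Fin g → Matrix (Fin n) (Fin n) ℝ

/-- The evaluation `p ↦ p(X)`: substitute `X_j` for `x_j` and the adjoint of `X_j` for `x_j^*`. -/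
noncomputable def eval {g n : ℕ} (X : MatTuple g n) :
    NCPoly g →ₐ[ℝ] Matrix (Fin n) (Fin n) ℝ :=
  MonoidAlgebra.lift ℝ (Matrix (Fin n) (Fin n) ℝ) (Word g)
    (FreeMonoid.lift (Sum.elim X (fun j => (X j).conjTranspose)))

/-- The polynomials which vanish at every point of every `S n`, where `n` is a positive size. -/
def hardVanishing {g : ℕ} (S : (n : ℕ) → Set (MatTuple g n)) : Set (NCPoly g) :=
  {p | ∀ n : ℕ, 0 < n → ∀ X ∈ S n, eval X p = 0}

/-- The hard variety of `I`: at each size `n`, the tuples which annihilate `I`. -/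
def hardVariety {g : ℕ} (I : Ideal (NCPoly g)) (n : ℕ) : Set (MatTuple g n) :=
  {X | ∀ p ∈ I, eval X p = 0}

/-- The hard radical of `I`. -/
def hardRadical {g : ℕ} (I : Ideal (NCPoly g)) : Set (NCPoly g) :=
  hardVanishing (hardVariety I)

end FreeStar

namespace FreeStar

variable {g : ℕ}

/-! Let `I` be the `*`-ideal; it is two-sided. As its generators are homogeneous, truncation
preserves `I`, so the left ideal `truncIdeal I d` contains `I` and has finite codimension. The left
regular action on the quotient kills `I` and detects every `q ∉ I` of degree at most `d`
(`exists_algHom_separating`), but need not respect adjoints.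

To repair this, let `x_j ↦ A`, `x_j^* ↦ B` and add the dual representation: `x_j ↦ A ⊕ Bᵀ`, `x_j^* ↦
B ⊕ Aᵀ` respects adjoints for the indefinite form `[[0,1],[1,0]]`. Replace this form by
`[[u,1],[1,u]]`, positive definite for `u > 1`, and scale `x_j` by `1 - u²` so that the adjoint
becomes polynomial in `u`. Homogeneous analytic relations survive, since they ignore `x_j^*` and
only pick up a power of `1 - u²`. Injectivity on a finite-dimensional space holds at `u = 0`, hence
at some `u > 1`. Part (b) follows from (a). -/

theorem wordAdj_mul (u v : Word g) : wordAdj (u * v) = wordAdj v * wordAdj u := by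
  simp [wordAdj]

theorem wordAdj_wordAdj (w : Word g) : wordAdj (wordAdj w) = w := by
  simp [wordAdj, List.map_reverse]

theorem length_wordAdj (w : Word g) : (wordAdj w).length = w.length := by
  simp [wordAdj, FreeMonoid.length]

@[simp]
theorem adj_single (w : Word g) (r : ℝ) :
    adj (MonoidAlgebra.single w r) = MonoidAlgebra.single (wordAdj w) r :=
  MonoidAlgebra.mapDomain_single

@[simp]
theorem adj_zero : adj (0 : NCPoly g) = 0 := MonoidAlgebra.mapDomain_zero _

@[simp]
theorem adj_add (p q : NCPoly g) : adj (p + q) = adj p + adj q := MonoidAlgebra.mapDomain_add _ _ _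

theorem adj_adj (p : NCPoly g) : adj (adj p) = p := by
  induction p using MonoidAlgebra.induction_linear with
  | zero => simp
  | add p q hp hq => simp [hp, hq]
  | single w r => simp [wordAdj_wordAdj]

theorem adj_mul (p q : NCPoly g) : adj (p * q) = adj q * adj p := by
  induction p using MonoidAlgebra.induction_linear with
  | zero => simp
  | add p p' hp hp' => simp [add_mul, mul_add, hp, hp']
  | single w r =>
    induction q using MonoidAlgebra.induction_linear with
    | zero => simp
    | add q q' hq hq' => simp [add_mul, mul_add, hq, hq']
    | single v s => simp [MonoidAlgebra.single_mul_single, wordAdj_mul, mul_comm]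

/-! ### `*`-ideals -/

theorem isStarIdeal_of_forall {J : Ideal (NCPoly g)} (h : ∀ p ∈ J, adj p ∈ J) :
    IsStarIdeal J := by
  refine Set.Subset.antisymm ?_ fun p hp => ⟨adj p, h p hp, adj_adj p⟩
  rintro _ ⟨p, hp, rfl⟩
  exact h p hp

theorem IsStarIdeal.adj_mem {J : Ideal (NCPoly g)} (hJ : IsStarIdeal J) {p : NCPoly g}
    (hp : p ∈ J) : adj p ∈ J := by
  have : adj p ∈ adj '' (J : Set (NCPoly g)) := ⟨p, hp, rfl⟩
  rw [hJ] at this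
  exact this

theorem starIdealSpan_le {P : Set (NCPoly g)} {J : Ideal (NCPoly g)}
    (hJ : ∀ p ∈ J, adj p ∈ J) (hP : P ⊆ J) : starIdealSpan P ≤ J :=
  sInf_le ⟨isStarIdeal_of_forall hJ, hP⟩

theorem subset_starIdealSpan (P : Set (NCPoly g)) : P ⊆ starIdealSpan P := fun _ hp =>
  Submodule.mem_sInf.2 fun _ hJ => hJ.2 hp

theorem adj_mem_starIdealSpan {P : Set (NCPoly g)} {p : NCPoly g} (hp : p ∈ starIdealSpan P) :
    adj p ∈ starIdealSpan P :=
  Submodule.mem_sInf.2 fun J hJ => hJ.1.adj_mem (Submodule.mem_sInf.1 hp J hJ)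

/-- The involution turns left multiplication into right multiplication. -/
theorem mul_mem_starIdealSpan {P : Set (NCPoly g)} {p : NCPoly g} (hp : p ∈ starIdealSpan P)
    (q : NCPoly g) : p * q ∈ starIdealSpan P := by
  have h := adj_mem_starIdealSpan
    (Ideal.mul_mem_left (starIdealSpan P) (adj q) (adj_mem_starIdealSpan hp))
  rwa [adj_mul, adj_adj, adj_adj] at h

/-! ### Truncation by degree -/

/-- The truncation of a polynomial: only the words of length at most `d` are kept. -/
noncomputable def trunc (d : ℕ) : NCPoly g →ₗ[ℝ] NCPoly g where
  toFun p := .ofCoeff (p.coeff.filter fun w => w.length ≤ d)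
  map_add' p q := by ext; simp [Finsupp.filter_add]
  map_smul' c p := by ext; simp [Finsupp.filter_smul]

theorem coeff_trunc (d : ℕ) (p : NCPoly g) :
    (trunc d p).coeff = p.coeff.filter fun w => w.length ≤ d := rfl

theorem trunc_single (d : ℕ) (w : Word g) (r : ℝ) :
    trunc d (MonoidAlgebra.single w r) =
      if w.length ≤ d then MonoidAlgebra.single w r else 0 := by
  apply MonoidAlgebra.coeff_injective
  rw [coeff_trunc, MonoidAlgebra.coeff_single]
  split_ifs with h
  · rw [Finsupp.filter_single_of_pos (fun v : Word g => v.length ≤ d) h]; rfl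
  · rw [Finsupp.filter_single_of_neg (fun v : Word g => v.length ≤ d) h]; rfl

theorem trunc_trunc (d e : ℕ) (p : NCPoly g) : trunc d (trunc e p) = trunc (min d e) p := by
  induction p using MonoidAlgebra.induction_linear with
  | zero => simp
  | add p q hp hq => simp [hp, hq]
  | single w r =>
    by_cases h : w.length ≤ e <;> by_cases h' : w.length ≤ d <;> simp [trunc_single, h, h']

theorem trunc_adj (d : ℕ) (p : NCPoly g) : trunc d (adj p) = adj (trunc d p) := by
  induction p using MonoidAlgebra.induction_linear with
  | zero => simp
  | add p q hp hq => simp [hp, hq]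
  | single w r =>
    by_cases h : w.length ≤ d <;> simp [trunc_single, length_wordAdj, h]

theorem trunc_single_mul (d : ℕ) (w : Word g) (r : ℝ) (p : NCPoly g) :
    trunc d (MonoidAlgebra.single w r * p) =
      if w.length ≤ d then MonoidAlgebra.single w r * trunc (d - w.length) p else 0 := by
  induction p using MonoidAlgebra.induction_linear with
  | zero => simp
  | add p q hp hq => rw [mul_add, map_add, hp, hq]; split_ifs <;> simp [mul_add]
  | single v s =>
    rw [MonoidAlgebra.single_mul_single, trunc_single, trunc_single, FreeMonoid.length_mul]
    by_cases h : w.length ≤ d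
    · by_cases h' : v.length ≤ d - w.length
      · rw [if_pos (by omega), if_pos h, if_pos h', MonoidAlgebra.single_mul_single]
      · rw [if_neg (by omega), if_pos h, if_neg h', mul_zero]
    · rw [if_neg (by omega), if_neg h]

theorem trunc_eq_self {d : ℕ} {p : NCPoly g} (hp : degree p ≤ d) : trunc d p = p := by
  apply MonoidAlgebra.coeff_injective
  rw [coeff_trunc, Finsupp.filter_eq_self_iff]
  intro w hw
  exact (Finset.le_sup (f := FreeMonoid.length) (Finsupp.mem_support_iff.2 hw)).trans hp

theorem IsHomogeneous.trunc_eq {p : NCPoly g} (hp : IsHomogeneous p) (d : ℕ) :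
    trunc d p = p ∨ trunc d p = 0 := by
  obtain ⟨k, hk⟩ := hp
  rcases le_or_gt k d with h | h
  · exact .inl (trunc_eq_self (Finset.sup_le fun w hw => (hk w hw).trans_le h))
  · right
    apply MonoidAlgebra.coeff_injective
    rw [coeff_trunc, MonoidAlgebra.coeff_zero, Finsupp.filter_eq_zero_iff]
    intro w hw
    by_contra hne
    have := hk w (Finsupp.mem_support_iff.2 hne)
    omega

/-- The polynomials all of whose truncations up to length `d` lie in a left ideal. -/
def truncIdeal (I : Ideal (NCPoly g)) (d : ℕ) : Ideal (NCPoly g) where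
  carrier := {p | ∀ k ≤ d, trunc k p ∈ I}
  add_mem' hp hq k hk := by rw [map_add]; exact I.add_mem (hp k hk) (hq k hk)
  zero_mem' k _ := by rw [map_zero]; exact I.zero_mem
  smul_mem' r p hp := by
    induction r using MonoidAlgebra.induction_linear with
    | zero => intro k _; simp
    | add r r' h h' =>
      intro k hk
      rw [add_smul, map_add]
      exact I.add_mem (h k hk) (h' k hk)
    | single w c =>
      intro k hk
      -- Multiplying by a word lowers the truncation level by its length; hence the condition at all
      -- levels up to `d`, not only at `d`.
      rw [smul_eq_mul, trunc_single_mul]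
      split_ifs
      · exact I.mul_mem_left _ (hp _ (by omega))
      · exact I.zero_mem

theorem starIdealSpan_le_truncIdeal {P : Set (NCPoly g)} (hP : ∀ p ∈ P, IsHomogeneous p) (d : ℕ) :
    starIdealSpan P ≤ truncIdeal (starIdealSpan P) d := by
  refine starIdealSpan_le (fun p hp k hk => ?_) fun p hp k _ => ?_
  · rw [trunc_adj]
    exact adj_mem_starIdealSpan (hp k hk)
  · rcases (hP p hp).trunc_eq k with h | h <;> rw [h]
    · exact subset_starIdealSpan P hp
    · exact Submodule.zero_mem _

/-- The space of polynomials of degree at most `d`. -/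
noncomputable abbrev degreeLE (g d : ℕ) : Submodule ℝ (NCPoly g) :=
  MonoidAlgebra.supported ℝ ℝ {w : Word g | w.length ≤ d}

instance (g d : ℕ) : FiniteDimensional ℝ (degreeLE g d) := by
  have : Finite {w : Word g | w.length ≤ d} := List.finite_length_le (Letter g) d
  unfold degreeLE
  rw [MonoidAlgebra.supported_eq_span_single]
  exact FiniteDimensional.span_of_finite ℝ (Set.Finite.image _ this)

theorem trunc_mem_degreeLE (d : ℕ) (p : NCPoly g) : trunc d p ∈ degreeLE g d := by
  intro w hw
  have : w ∈ (trunc d p).coeff.support := hw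
  rw [coeff_trunc, Finsupp.support_filter, Finset.mem_filter] at this
  exact this.2

/-! ### Substitution in arbitrary algebras -/

open Polynomial

/-- Substitution of `a j` for `x_j` and `b j` for `x_j^*` in an arbitrary algebra. -/
noncomputable def subst {R : Type*} [Semiring R] [Algebra ℝ R] (a b : Fin g → R) :
    NCPoly g →ₐ[ℝ] R :=
  MonoidAlgebra.lift ℝ R (Word g) (FreeMonoid.lift (Sum.elim a b))

section subst

variable {R R' : Type*} [Ring R] [Algebra ℝ R] [Ring R'] [Algebra ℝ R']

theorem subst_single (a b : Fin g → R) (w : Word g) (r : ℝ) :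
    subst a b (MonoidAlgebra.single w r) = r • FreeMonoid.lift (Sum.elim a b) w :=
  MonoidAlgebra.lift_single _ _ _

theorem eval_eq_subst {n : ℕ} (X : MatTuple g n) :
    eval X = subst X fun j => (X j).conjTranspose := rfl

theorem algHom_ext_letter {f f' : NCPoly g →ₐ[ℝ] R}
    (h : ∀ l, f (MonoidAlgebra.single (FreeMonoid.of l) 1) =
      f' (MonoidAlgebra.single (FreeMonoid.of l) 1)) : f = f' :=
  (MonoidAlgebra.lift ℝ R (Word g)).symm.injective (FreeMonoid.hom_eq h)

theorem map_subst (f : R →ₐ[ℝ] R') (a b : Fin g → R) (p : NCPoly g) :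
    f (subst a b p) = subst (fun j => f (a j)) (fun j => f (b j)) p := by
  have h : f.comp (subst a b) = subst (fun j => f (a j)) (fun j => f (b j)) := by
    refine algHom_ext_letter fun l => ?_
    rcases l with j | j <;> simp [subst]
  exact DFunLike.congr_fun h p

theorem eq_subst (f : NCPoly g →ₐ[ℝ] R) :
    f = subst (fun j => f (MonoidAlgebra.single (FreeMonoid.of (Sum.inl j)) 1))
      (fun j => f (MonoidAlgebra.single (FreeMonoid.of (Sum.inr j)) 1)) := by
  refine algHom_ext_letter fun l => ?_
  rcases l with j | j <;> simp [subst]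

theorem subst_mul_of_intertwines {a b a' b' : Fin g → R} {s : R}
    (ha : ∀ j, a' j * s = s * a j) (hb : ∀ j, b' j * s = s * b j) (p : NCPoly g) :
    subst a' b' p * s = s * subst a b p := by
  induction p using MonoidAlgebra.induction_linear with
  | zero => simp
  | add p q hp hq => simp [add_mul, mul_add, hp, hq]
  | single w r =>
    rw [subst_single, subst_single, smul_mul_assoc, mul_smul_comm]
    congr 1
    induction w using FreeMonoid.inductionOn' with
    | one => simp
    | of_mul l w ih =>
      rw [map_mul, map_mul, mul_assoc, ih, ← mul_assoc, ← mul_assoc]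
      congr 1
      rcases l with j | j <;> simp [ha, hb]

/-- On homogeneous analytic polynomials, scaling the `x_j` scales the value, and the values of the
`x_j^*` do not matter. -/
theorem subst_smul_of_isAnalytic {p : NCPoly g} (hp : IsAnalytic p) {k : ℕ}
    (hk : ∀ w ∈ p.coeff.support, FreeMonoid.length w = k) (c : ℝ) (a b b' : Fin g → R) :
    subst (fun j => c • a j) b p = c ^ k • subst a b' p := by
  have key : ∀ w : Word g, (∀ l ∈ FreeMonoid.toList w, ∃ j : Fin g, l = Sum.inl j) →
      FreeMonoid.lift (Sum.elim (fun j => c • a j) b) w =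
        c ^ w.length • FreeMonoid.lift (Sum.elim a b') w := by
    intro w hw
    induction w using FreeMonoid.inductionOn' with
    | one => simp
    | of_mul l w ih =>
      obtain ⟨j, rfl⟩ := hw l (by simp)
      rw [map_mul, ih fun l hl => hw l (by simp [hl]), map_mul, FreeMonoid.length_mul]
      simp only [FreeMonoid.lift_eval_of, Sum.elim_inl, FreeMonoid.length_of, smul_mul_assoc,
        mul_smul_comm, smul_smul]
      rw [pow_add, pow_one, mul_comm]
  rw [subst, subst, MonoidAlgebra.lift_apply, MonoidAlgebra.lift_apply, Finsupp.sum, Finsupp.sum,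
    Finset.smul_sum]
  refine Finset.sum_congr rfl fun w hw => ?_
  rw [key w (hp w hw), hk w hw, smul_comm]

end subst

/-! ### Dual representations and polynomial families of matrices -/

section blocks

variable {ι : Type*} [Fintype ι] [DecidableEq ι]

/-- The direct sum of a representation and of the dual one. -/
theorem subst_fromBlocks (A B : Fin g → Matrix ι ι ℝ) (p : NCPoly g) :
    subst (fun j => Matrix.fromBlocks (A j) 0 0 (B j).transpose)
        (fun j => Matrix.fromBlocks (B j) 0 0 (A j).transpose) p =
      Matrix.fromBlocks (subst A B p) 0 0 (subst A B (adj p)).transpose := by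
  induction p using MonoidAlgebra.induction_linear with
  | zero => simp
  | add p q hp hq => simp [hp, hq, Matrix.fromBlocks_add]
  | single w r =>
    rw [adj_single, subst_single, subst_single, subst_single, Matrix.transpose_smul,
      ← smul_zero (A := Matrix ι ι ℝ) r, ← Matrix.fromBlocks_smul]
    congr 1
    rw [smul_zero]
    induction w using FreeMonoid.inductionOn' with
    | one => simp [wordAdj, Matrix.fromBlocks_one]
    | of_mul l w ih =>
      rw [map_mul, ih, wordAdj_mul, map_mul, map_mul, Matrix.transpose_mul]
      rcases l with j | j <;> simp [wordAdj, Matrix.fromBlocks_multiply]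

/-- The values at `u` of a family of linear maps which is polynomial in `u` and injective at `0` are
injective for some `u > 1`. -/
theorem exists_gt_one_forall_eq_zero {V : Type*} [AddCommGroup V] [Module ℝ V]
    [FiniteDimensional ℝ V] (F : V →ₗ[ℝ] Matrix ι ι ℝ[X]) (T : Matrix ι ι ℝ →ₗ[ℝ] V)
    (h0 : ∀ v, T ((F v).map (Polynomial.eval 0)) = v) :
    ∃ u : ℝ, 1 < u ∧ ∀ v, (F v).map (Polynomial.eval u) = 0 → v = 0 := by
  have hT : ∀ (f : Matrix ι ι ℝ →ₗ[ℝ] ℝ) (M : Matrix ι ι ℝ[X]), ∃ p : ℝ[X], ∀ u : ℝ,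
      p.eval u = f (M.map (Polynomial.eval u)) := by
    intro f M
    refine ⟨∑ i, ∑ j, C (f (Matrix.single i j 1)) * M i j, fun u => ?_⟩
    conv_rhs => rw [Matrix.matrix_eq_sum_single (M.map (Polynomial.eval u))]
    simp only [map_sum, eval_finsetSum, eval_mul, eval_C, Matrix.map_apply]
    refine Finset.sum_congr rfl fun i _ => Finset.sum_congr rfl fun j _ => ?_
    rw [show Matrix.single i j ((M i j).eval u) = (M i j).eval u • Matrix.single i j (1 : ℝ) by
      rw [Matrix.smul_single, smul_eq_mul, mul_one], map_smul, smul_eq_mul, mul_comm]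
  let b := Module.finBasis ℝ V
  let E : ℝ → V →ₗ[ℝ] V := fun u =>
    T ∘ₗ (Polynomial.aeval u : ℝ[X] →ₐ[ℝ] ℝ).mapMatrix.toLinearMap ∘ₗ F
  have hE : ∀ u v, E u v = T ((F v).map (Polynomial.eval u)) := fun u v => rfl
  choose Q hQ using fun i j => hT (b.coord i ∘ₗ T) (F (b j))
  have hdet : ∀ u, (Matrix.of Q).det.eval u = LinearMap.det (E u) := by
    intro u
    rw [← LinearMap.det_toMatrix b, ← Polynomial.coe_evalRingHom, RingHom.map_det]
    congr 1
    ext i j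
    simp [LinearMap.toMatrix_apply, hQ, hE]
  -- The determinant is polynomial in `u` with value `1` at `0`, so it has finitely many roots.
  have hne : (Matrix.of Q).det ≠ 0 := by
    intro h
    have h1 := hdet 0
    have : E 0 = LinearMap.id := LinearMap.ext fun v => h0 v
    rw [h, this, LinearMap.det_id] at h1
    simp at h1
  obtain ⟨u, hu, hroot⟩ :=
    (Set.Ioi_infinite (1 : ℝ)).exists_notMem_finset (Matrix.of Q).det.roots.toFinset
  refine ⟨u, hu, fun v hv => ?_⟩
  have hdu : LinearMap.det (E u) ≠ 0 := by
    rw [← hdet]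
    intro h
    exact hroot (by simp [hne, h])
  refine (LinearMap.equivOfDetNeZero (E u) hdu).injective ?_
  rw [map_zero]
  change E u v = 0
  rw [hE, hv, map_zero]

/-- A matrix with values in polynomials in `u`, equal to the direct sum of `B` and of the transpose
of `A` at `u = 0`, and for `u > 1` equal to `1 - u ^ 2` times the adjoint of the direct sum of `A`
and the transpose of `B` for a suitable inner product. -/
noncomputable def adjFamily {R : Type*} [CommRing R] (A B : Matrix ι ι R) (u : R) :
    Matrix (ι ⊕ ι) (ι ⊕ ι) R :=
  Matrix.fromBlocks (B - u ^ 2 • A.transpose) (u • (B - A.transpose))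
    (u • (A.transpose - B)) (A.transpose - u ^ 2 • B)

/-- The squared block matrix is the Gram matrix `[[u,1],[1,u]]`. -/
theorem adjFamily_intertwines (A B : Matrix ι ι ℝ) {a b u : ℝ} (hu : a ^ 2 + b ^ 2 = u)
    (hab : 2 * a * b = 1) :
    ((1 - u ^ 2) • (Matrix.fromBlocks A 0 0 B.transpose)).transpose *
        (Matrix.fromBlocks (a • 1) (b • 1) (b • 1) (a • 1) *
          Matrix.fromBlocks (a • 1) (b • 1) (b • 1) (a • 1)) =
      (Matrix.fromBlocks (a • 1) (b • 1) (b • 1) (a • 1) *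
          Matrix.fromBlocks (a • 1) (b • 1) (b • 1) (a • 1)) * adjFamily A B u := by
  have h1 : a * a + b * b = u := by rw [← hu]; ring
  have h2 : a * b + b * a = 1 := by rw [← hab]; ring
  have h3 : b * b + a * a = u := by rw [← hu]; ring
  have h4 : b * a + a * b = 1 := by rw [← hab]; ring
  simp only [Matrix.fromBlocks_multiply, Matrix.smul_mul, Matrix.mul_smul, Matrix.one_mul,
    Matrix.mul_one, smul_smul, ← add_smul, h1, h2, h3, h4, adjFamily, Matrix.fromBlocks_transpose,
    Matrix.transpose_smul, Matrix.transpose_zero, Matrix.transpose_transpose,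
    Matrix.fromBlocks_smul]
  rw [Matrix.fromBlocks_inj]
  refine ⟨?_, ?_, ?_, ?_⟩ <;> module

end blocks

/-! ### Deformation to a positive definite form -/

section deformation

variable {ι : Type*} [Fintype ι] [DecidableEq ι]

/-- A representation, polynomial in `u`, which for `u > 1` is a `*`-representation for a suitable
inner product. -/
noncomputable def deform (A B : Fin g → Matrix ι ι ℝ) (u : ℝ) :
    NCPoly g →ₐ[ℝ] Matrix (ι ⊕ ι) (ι ⊕ ι) ℝ :=
  subst (fun j => (1 - u ^ 2) • Matrix.fromBlocks (A j) 0 0 (B j).transpose)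
    fun j => adjFamily (A j) (B j) u

/-- The family `deform` as a matrix of polynomials. -/
noncomputable def deformPoly (A B : Fin g → Matrix ι ι ℝ) :
    NCPoly g →ₐ[ℝ] Matrix (ι ⊕ ι) (ι ⊕ ι) ℝ[X] :=
  subst (fun j => (1 - X ^ 2 : ℝ[X]) •
      Matrix.fromBlocks ((A j).map C) 0 0 ((B j).transpose.map C))
    fun j => adjFamily ((A j).map C) ((B j).map C) X

theorem map_deformPoly (A B : Fin g → Matrix ι ι ℝ) (p : NCPoly g) (u : ℝ) :
    (deformPoly A B p).map (Polynomial.eval u) = deform A B u p := by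
  change (Polynomial.aeval u : ℝ[X] →ₐ[ℝ] ℝ).mapMatrix _ = _
  rw [deformPoly, map_subst, deform]
  congr 2
  · ext j i i'
    rcases i with i | i <;> rcases i' with i' | i' <;> simp
  · ext j i i'
    rcases i with i | i <;> rcases i' with i' | i' <;> simp [adjFamily] <;> ring

theorem deform_zero (A B : Fin g → Matrix ι ι ℝ) (p : NCPoly g) :
    deform A B 0 p =
      Matrix.fromBlocks (subst A B p) 0 0 (subst A B (adj p)).transpose := by
  rw [← subst_fromBlocks, deform]
  congr 2 <;> ext1 j <;> simp [adjFamily]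

/-- Since `p` ignores the images of `x_j^*`, these may be reset to their values at `u = 0`. -/
theorem deform_eq_zero (A B : Fin g → Matrix ι ι ℝ) {p : NCPoly g} (hp : IsAnalytic p)
    (hp' : IsHomogeneous p) (h : subst A B p = 0) (h' : subst A B (adj p) = 0) (u : ℝ) :
    deform A B u p = 0 := by
  obtain ⟨k, hk⟩ := hp'
  rw [deform, subst_smul_of_isAnalytic hp hk _ _ _
    (fun j => Matrix.fromBlocks (B j) 0 0 (A j).transpose), subst_fromBlocks, h, h']
  simp

/-- For `u > 1`, the representation `deform A B u` is similar to a `*`-representation. -/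
theorem exists_conjTranspose_pair (A B : Fin g → Matrix ι ι ℝ) {u : ℝ} (hu : 1 < u) :
    ∃ S : Matrix (ι ⊕ ι) (ι ⊕ ι) ℝ, IsUnit S ∧ ∃ Y : Fin g → Matrix (ι ⊕ ι) (ι ⊕ ι) ℝ,
      ∀ p, subst Y (fun j => (Y j).conjTranspose) p * S =
        S * deform A B u p := by
  -- `S` below is the positive square root of `[[u,1],[1,u]]`: its eigenvalues are `a + b = √(u +
  -- 1)` and `a - b = √(u - 1)`.
  obtain ⟨a, b, hab, hab', hne⟩ : ∃ a b : ℝ, a ^ 2 + b ^ 2 = u ∧ 2 * a * b = 1 ∧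
      a ^ 2 - b ^ 2 ≠ 0 := by
    have h1 : √(u + 1) ^ 2 = u + 1 := Real.sq_sqrt (by linarith)
    have h2 : √(u - 1) ^ 2 = u - 1 := Real.sq_sqrt (by linarith)
    have h3 : 0 < √(u + 1) := Real.sqrt_pos.2 (by linarith)
    have h4 : 0 < √(u - 1) := Real.sqrt_pos.2 (by linarith)
    refine ⟨(√(u + 1) + √(u - 1)) / 2, (√(u + 1) - √(u - 1)) / 2, by linarith, by linarith, ?_⟩
    have : ((√(u + 1) + √(u - 1)) / 2) ^ 2 - ((√(u + 1) - √(u - 1)) / 2) ^ 2 =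
      √(u + 1) * √(u - 1) := by ring
    rw [this]
    positivity
  let S : Matrix (ι ⊕ ι) (ι ⊕ ι) ℝ := Matrix.fromBlocks (a • 1) (b • 1) (b • 1) (a • 1)
  set c := (a ^ 2 - b ^ 2)⁻¹
  let S' : Matrix (ι ⊕ ι) (ι ⊕ ι) ℝ := c •
    Matrix.fromBlocks (a • 1) (-b • 1) (-b • 1) (a • 1)
  have hSS' : S * S' = 1 := by
    have hc := inv_mul_cancel₀ hne
    simp only [S, S', Matrix.mul_smul, Matrix.fromBlocks_multiply, Matrix.smul_mul,
      Matrix.one_mul, smul_smul, ← add_smul, Matrix.fromBlocks_smul]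
    rw [← Matrix.fromBlocks_one, Matrix.fromBlocks_inj]
    refine ⟨?_, ?_, ?_, ?_⟩ <;>
      first
      | (refine (congrArg (· • (1 : Matrix ι ι ℝ)) ?_).trans (one_smul ℝ _)
         linear_combination hc)
      | (refine (congrArg (· • (1 : Matrix ι ι ℝ)) ?_).trans (zero_smul ℝ _)
         ring)
  have hS'S : S' * S = 1 := mul_eq_one_comm.1 hSS'
  have hST : S.transpose = S := by simp [S, Matrix.fromBlocks_transpose]
  have hS'T : S'.transpose = S' := by simp [S', Matrix.fromBlocks_transpose]
  refine ⟨S, IsUnit.of_mul_eq_one S' hSS',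
    fun j => S * ((1 - u ^ 2) • Matrix.fromBlocks (A j) 0 0 (B j).transpose) * S', fun p => ?_⟩
  refine subst_mul_of_intertwines (fun j => ?_) (fun j => ?_) p
  · rw [mul_assoc, hS'S, mul_one]
  · have key := adjFamily_intertwines (A j) (B j) hab hab'
    change _ * (S * S) = (S * S) * _ at key
    rw [Matrix.conjTranspose_eq_transpose_of_trivial, Matrix.transpose_mul, Matrix.transpose_mul,
      hST, hS'T]
    calc _ = S' * (((1 - u ^ 2) • Matrix.fromBlocks (A j) 0 0 (B j).transpose).transpose *
          (S * S)) := by simp only [mul_assoc]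
      _ = (S' * S) * (S * adjFamily (A j) (B j) u) := by rw [key]; simp only [mul_assoc]
      _ = _ := by rw [hS'S, one_mul]

end deformation

/-! ### From representations to matrix tuples -/

theorem exists_matTuple_reindex {κ : Type*} [Fintype κ] [DecidableEq κ] {n : ℕ} (e : κ ≃ Fin n)
    (Y : Fin g → Matrix κ κ ℝ) :
    ∃ Z : MatTuple g n, ∀ p, eval Z p = 0 ↔ subst Y (fun j => (Y j).conjTranspose) p = 0 := by
  obtain ⟨f, hf, hstar⟩ : ∃ f : Matrix κ κ ℝ →ₐ[ℝ] Matrix (Fin n) (Fin n) ℝ,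
      Function.Injective f ∧ ∀ M, f M.conjTranspose = (f M).conjTranspose :=
    ⟨(Matrix.reindexAlgEquiv ℝ ℝ e).toAlgHom, (Matrix.reindexAlgEquiv ℝ ℝ e).injective,
      fun _ => rfl⟩
  refine ⟨fun j => f (Y j), fun p => ?_⟩
  rw [eval_eq_subst, ← map_eq_zero_iff f hf, map_subst]
  simp only [hstar]

/-- A representation which need not respect adjoints can be replaced by the evaluation at a tuple of
matrices, keeping homogeneous analytic relations and injectivity on a finite-dimensional space. -/
theorem exists_matTuple_of_algHom {m : ℕ} (ρ : NCPoly g →ₐ[ℝ] Matrix (Fin m) (Fin m) ℝ)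
    {P : Set (NCPoly g)} (hP : ∀ p ∈ P, IsAnalytic p ∧ IsHomogeneous p)
    (hρ : ∀ p ∈ P, ρ p = 0 ∧ ρ (adj p) = 0) (V : Submodule ℝ (NCPoly g)) [FiniteDimensional ℝ V]
    (hV : ∀ q ∈ V, ρ q = 0 → q = 0) :
    ∃ Y : MatTuple g (m + m), (∀ p ∈ P, eval Y p = 0) ∧ ∀ q ∈ V, eval Y q = 0 → q = 0 := by
  obtain ⟨A, B, rfl⟩ : ∃ A B, ρ = subst A B := ⟨_, _, eq_subst ρ⟩
  obtain ⟨T, hT⟩ := ((subst A B).toLinearMap ∘ₗ V.subtype).exists_leftInverse_of_injective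
    ((LinearMap.ker_eq_bot').2 fun q hq => Subtype.ext (hV q q.2 hq))
  obtain ⟨U, hU⟩ : ∃ U : Matrix (Fin m ⊕ Fin m) (Fin m ⊕ Fin m) ℝ →ₗ[ℝ]
      Matrix (Fin m) (Fin m) ℝ, ∀ M, U M = M.toBlocks₁₁ :=
    ⟨{ toFun := Matrix.toBlocks₁₁
       map_add' := fun _ _ => rfl
       map_smul' := fun _ _ => rfl }, fun _ => rfl⟩
  -- At `u = 0` the upper left block is the original representation, which `T` inverts on `V`.
  obtain ⟨u, hu, hinj⟩ := exists_gt_one_forall_eq_zero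
    ((deformPoly A B).toLinearMap ∘ₗ V.subtype) (T ∘ₗ U) (fun v => by
      rw [LinearMap.comp_apply, LinearMap.comp_apply, AlgHom.toLinearMap_apply, map_deformPoly,
        deform_zero, hU, Matrix.toBlocks_fromBlocks₁₁]
      exact LinearMap.congr_fun hT v)
  obtain ⟨S, hS, Y, hY⟩ := exists_conjTranspose_pair A B hu
  obtain ⟨Z, hZ⟩ := exists_matTuple_reindex (finSumFinEquiv (m := m) (n := m)) Y
  have hzero : ∀ p, eval Z p = 0 ↔ deform A B u p = 0 := by
    intro p
    rw [hZ, ← hS.mul_left_eq_zero, hY, hS.mul_right_eq_zero]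
  refine ⟨Z, fun p hp => ?_, fun q hq h => ?_⟩
  · rw [hzero]
    exact deform_eq_zero A B (hP p hp).1 (hP p hp).2 (hρ p hp).1 (hρ p hp).2 u
  · rw [hzero, ← map_deformPoly] at h
    exact congrArg Subtype.val (hinj ⟨q, hq⟩ h)

theorem eval_adj {n : ℕ} (Y : MatTuple g n) (p : NCPoly g) :
    eval Y (adj p) = (eval Y p).conjTranspose := by
  induction p using MonoidAlgebra.induction_linear with
  | zero => simp
  | add p q hp hq => simp [hp, hq]
  | single w r =>
    rw [adj_single, eval_eq_subst, subst_single, subst_single, Matrix.conjTranspose_smul,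
      star_trivial]
    congr 1
    induction w using FreeMonoid.inductionOn' with
    | one => simp [wordAdj]
    | of_mul l w ih =>
      rw [wordAdj_mul, map_mul, map_mul, ih, Matrix.conjTranspose_mul]
      rcases l with j | j <;> simp [wordAdj]

theorem eval_eq_zero_of_mem_starIdealSpan {P : Set (NCPoly g)} {n : ℕ} {Y : MatTuple g n}
    (hY : ∀ p ∈ P, eval Y p = 0) {p : NCPoly g} (hp : p ∈ starIdealSpan P) : eval Y p = 0 := by
  refine RingHom.mem_ker.1 (starIdealSpan_le (J := RingHom.ker (eval Y)) (fun q hq => ?_) hY hp)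
  rw [RingHom.mem_ker] at hq ⊢
  rw [eval_adj, hq, Matrix.conjTranspose_zero]

/-! ### Separation in bounded degree -/

/-- Modulo the `*`-ideal generated by homogeneous polynomials, a finite-dimensional representation
separates the polynomials of bounded degree. -/
theorem exists_algHom_separating {P : Set (NCPoly g)} (hP : ∀ p ∈ P, IsHomogeneous p) (d : ℕ) :
    ∃ (m : ℕ) (ρ : NCPoly g →ₐ[ℝ] Matrix (Fin m) (Fin m) ℝ),
      (∀ p ∈ starIdealSpan P, ρ p = 0) ∧
      ∀ q, degree q ≤ d → ρ q = 0 → q ∈ starIdealSpan P := by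
  set K := truncIdeal (starIdealSpan P) d
  have htrunc : ∀ q, q - trunc d q ∈ K := by
    intro q k hk
    rw [map_sub, trunc_trunc, min_eq_left hk, sub_self]
    exact Submodule.zero_mem _
  let π : NCPoly g →ₗ[ℝ] NCPoly g ⧸ K := (Submodule.mkQ K).restrictScalars ℝ
  have hfin : FiniteDimensional ℝ (NCPoly g ⧸ K) := by
    refine Module.Finite.of_surjective (π ∘ₗ (degreeLE g d).subtype) fun y => ?_
    obtain ⟨q, rfl⟩ := Submodule.mkQ_surjective K y
    refine ⟨⟨trunc d q, trunc_mem_degreeLE d q⟩, ?_⟩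
    exact ((Submodule.Quotient.eq K).2 (htrunc q)).symm
  let τ := LinearMap.toMatrixAlgEquiv (Module.finBasis ℝ (NCPoly g ⧸ K))
  refine ⟨_, τ.toAlgHom.comp (Algebra.lsmul ℝ ℝ (NCPoly g ⧸ K)), fun p hp => ?_, fun q hq h => ?_⟩
  · refine (EmbeddingLike.map_eq_zero_iff (f := τ)).2 (LinearMap.ext fun y => ?_)
    obtain ⟨r, rfl⟩ := Submodule.mkQ_surjective K y
    exact (Submodule.Quotient.mk_eq_zero K).2
      (starIdealSpan_le_truncIdeal hP d (mul_mem_starIdealSpan hp r))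
  · have h' := LinearMap.congr_fun ((EmbeddingLike.map_eq_zero_iff (f := τ)).1 h)
      (Submodule.Quotient.mk 1)
    have h'' : q • (1 : NCPoly g) ∈ K := (Submodule.Quotient.mk_eq_zero K).1 h'
    rw [smul_eq_mul, mul_one] at h''
    rw [← trunc_eq_self hq]
    exact h'' d le_rfl

theorem degree_le_iff_mem_degreeLE {d : ℕ} {q : NCPoly g} : degree q ≤ d ↔ q ∈ degreeLE g d := by
  rw [degree, Finset.sup_le_iff]
  rfl

theorem exists_separating_matTuple {P : Set (NCPoly g)}
    (hP : ∀ p ∈ P, IsAnalytic p ∧ IsHomogeneous p) (hI : starIdealSpan P ≠ ⊤) (d : ℕ) :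
    ∃ n : ℕ, 0 < n ∧ ∃ Y : MatTuple g n, (∀ p ∈ starIdealSpan P, eval Y p = 0) ∧
      ∀ q, q ∉ starIdealSpan P → degree q ≤ d → eval Y q ≠ 0 := by
  obtain ⟨m, ρ, hker, hsep⟩ := exists_algHom_separating (fun p hp => (hP p hp).2) d
  have hm : m ≠ 0 := by
    rintro rfl
    refine hI ((Ideal.eq_top_iff_one _).2 (hsep 1 ?_ (Subsingleton.elim _ _)))
    refine Finset.sup_le fun w hw => ?_
    rw [MonoidAlgebra.one_def, MonoidAlgebra.coeff_single] at hw
    rw [Finset.mem_singleton.1 (Finsupp.support_single_subset hw)]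
    simp
  -- On a complement of `I` in degree at most `d`, `ρ` is injective.
  obtain ⟨V', hV'⟩ := Submodule.exists_isCompl
    (((starIdealSpan P).restrictScalars ℝ).comap (degreeLE g d).subtype)
  obtain ⟨Y, hY, hinj⟩ := exists_matTuple_of_algHom ρ hP
    (fun p hp => ⟨hker p (subset_starIdealSpan P hp),
      hker _ (adj_mem_starIdealSpan (subset_starIdealSpan P hp))⟩)
    (V'.map (degreeLE g d).subtype) (by
      rintro _ ⟨v, hv, rfl⟩ h
      have hvI := hsep v (degree_le_iff_mem_degreeLE.2 v.2) h
      exact congrArg Subtype.val (Submodule.disjoint_def.1 hV'.disjoint v hvI hv))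
  refine ⟨m + m, by omega, Y, fun p hp => eval_eq_zero_of_mem_starIdealSpan hY hp,
    fun q hq hqd h => hq ?_⟩
  obtain ⟨a, ha, v, hv, hav⟩ := Submodule.mem_sup.1
    (hV'.sup_eq_top.ge (Submodule.mem_top (x := ⟨q, degree_le_iff_mem_degreeLE.1 hqd⟩)))
  have hav' : (a : NCPoly g) + v = q := congrArg Subtype.val hav
  have hv0 : (v : NCPoly g) = 0 := by
    refine hinj v ⟨v, hv, rfl⟩ ?_
    have haY : eval Y (a : NCPoly g) = 0 := eval_eq_zero_of_mem_starIdealSpan hY ha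
    rwa [← hav', map_add, haY, zero_add] at h
  rw [← hav', hv0, add_zero]
  exact ha

end FreeStar

theorem theorem4p8 (g : ℕ) (P : Set (FreeStar.NCPoly g))
    (hP : ∀ p ∈ P, FreeStar.IsAnalytic p ∧ FreeStar.IsHomogeneous p) :
    (FreeStar.starIdealSpan P ≠ ⊤ →
      ∀ d : ℕ, ∃ n : ℕ, 0 < n ∧ ∃ X : FreeStar.MatTuple g n,
        (∀ p ∈ FreeStar.starIdealSpan P, FreeStar.eval X p = 0) ∧
        (∀ q : FreeStar.NCPoly g, q ∉ FreeStar.starIdealSpan P → FreeStar.degree q ≤ d →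
          FreeStar.eval X q ≠ 0)) ∧
    FreeStar.hardRadical (FreeStar.starIdealSpan P) =
      (FreeStar.starIdealSpan P : Set (FreeStar.NCPoly g)) := by
  refine ⟨fun hI d => FreeStar.exists_separating_matTuple hP hI d,
    Set.Subset.antisymm (fun q hq => ?_) fun q hq n _ Y hY => hY q hq⟩
  by_contra hqI
  obtain ⟨n, hn, Y, hY, hsep⟩ := FreeStar.exists_separating_matTuple hP
    (fun h => hqI (by rw [h]; trivial)) (FreeStar.degree q)
  exact hsep q hqI le_rfl (hq n hn Y hY)
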